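/- All rings are commutative with identity, and $\mathbb{N}=\{0,1,2,\dots\}$. For an abelian group $G$, a $G$-graded ring is a ring $R$ with additive subgroups $R_g$ ($g\in G$) such that $R=\bigoplus_{g\in G}R_g$ and $R_gR_h\subseteq R_{g+h}$; put $\operatorname{Supp}(R)=\{g\in G: R_g\neq 0\}$. A $G$-graded field is a $G$-graded ring with exactly two homogeneous ideals, namely $0$ and $R$. Let $k$ be a field of characteristic $0$. (1) Let $d\in\mathbb{N}$ and let $(p_i)_{i\in\mathbb{N}}$ be any sequence of prime numbers such that $\mathbb{Q}=\bigcup_{i}\frac{1}{p_0p_1\cdots p_{i-1}}\mathbb{Z}$. Let $K=k(\alpha_{j,i}: 1\le j\le d,\ i\in\mathbb{N})$ be the field of rational functions in the indeterminates $\alpha_{j,i}$. For $i\in\mathbb{N}$ let $R_i=K[t_{1,i}^{\pm1},\dots,t_{d,i}^{\pm1}]$ be a Laurent polynomial ring, and let $\phi_i:R_i\to R_{i+1}$ be the homomorphism of $K$-algebras with $t_{j,i}\mapsto \alpha_{j,i+1}^{-1}t_{j,i+1}^{p_i}$ for $1\le j\le d$. Let $R(k,d)=\varinjlim R_i$ be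 the direct limit along the maps $\phi_i$. Then the ring $R(k,d)$ is Noetherian. Moreover, giving the elements of $K$ degree $0$ and setting $\deg t_{j,i}=\frac{1}{p_0p_1\cdots p_{i-1}}e_j$, where $e_1,\dots,e_d$ is the standard basis of $\mathbb{Q}^d$, makes $R(k,d)$ a $\mathbb{Q}^d$-graded ring, which is a $\mathbb{Q}^d$-graded field with $R(k,d)_g\neq 0$ for every $g\in\mathbb{Q}^d$. (2) For every torsion-free abelian group $G$ of finite rank there is a Noetherian ring $R$ with a $G$-grading that makes it a $G$-graded field such that $\operatorname{Supp}(R)=G$ and $R_0= k(\alpha_i, i\in\mathbb{N})$, the field of rational functions over $k$ in countably many indeterminates. -/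

import Mathlib

universe u v

/-- The rational function field `k(α_s, s ∈ σ)`. -/
abbrev RatFunField (σ : Type v) (k : Type u) [Field k] : Type (max u v) :=
  FractionRing (MvPolynomial σ k)

/-- `Supp(R) = {g : R_g ≠ 0}` for a family `𝒜` of homogeneous components of `R`. -/
def gradedSupport {ι σ A : Type*} [Zero A] [SetLike σ A] (𝒜 : ι → σ) : Set ι :=
  {g | ∃ x ∈ 𝒜 g, x ≠ 0}

/-- A graded commutative ring is a graded field if it has exactly two homogeneous ideals,
namely `0` and the whole ring. -/
def IsGradedField {ι σ A : Type*} [DecidableEq ι] [AddCommGroup ι] [CommRing A]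
    [SetLike σ A] [AddSubgroupClass σ A] (𝒜 : ι → σ) [GradedRing 𝒜] : Prop :=
  Nontrivial A ∧ ∀ I : Ideal A, I.IsHomogeneous 𝒜 → I = ⊥ ∨ I = ⊤

namespace LaurentTower

/-- The coefficient field `K = k(α_{j,n})`, where `1 ≤ j ≤ d` is encoded by `Fin d` and the
second index runs over `ℕ = {0, 1, 2, …}`. -/
abbrev Coeff (k : Type u) [Field k] (d : ℕ) : Type u := RatFunField (Fin d × ℕ) k

/-- The indeterminate `α_{j,n}` as an element of `K`. -/
noncomputable def alpha (k : Type u) [Field k] {d : ℕ} (j : Fin d) (n : ℕ) : Coeff k d :=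
  algebraMap (MvPolynomial (Fin d × ℕ) k) (Coeff k d) (MvPolynomial.X (j, n))

/-- The ring `R_n = K[t_1, …, t_d, t_1⁻¹, …, t_d⁻¹]` of Laurent polynomials in `d` variables
over `K`, the group algebra of `ℤ^d` (the monomial `t^m` is `AddMonoidAlgebra.single m 1`). -/
abbrev Level (k : Type u) [Field k] (d _n : ℕ) : Type u :=
  AddMonoidAlgebra (Coeff k d) (Fin d → ℤ)

/-- The variable `t_{j,n}` of `R_n`. -/
noncomputable def t (k : Type u) [Field k] {d : ℕ} (j : Fin d) (n : ℕ) : Level k d n :=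
  AddMonoidAlgebra.single (Pi.single j 1) 1

lemma alpha_ne_zero (k : Type u) [Field k] {d : ℕ} (j : Fin d) (n : ℕ) : alpha k j n ≠ 0 := by
  simp [alpha]

/-- The homomorphism of `K`-algebras `φ_n : R_n → R_{n+1}` with
`t_{j,n} ↦ α_{j,n+1}⁻¹ t_{j,n+1} ^ p_n`; on monomials it is
`t^m ↦ (∏_j α_{j,n+1} ^ (-m_j)) t^{p_n m}`. -/
noncomputable def step (k : Type u) [Field k] (d : ℕ) (p : ℕ → ℕ) (n : ℕ) :
    Level k d n →ₐ[Coeff k d] Level k d (n + 1) :=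
  AddMonoidAlgebra.lift (Coeff k d) (Level k d (n + 1)) (Fin d → ℤ)
    { toFun := fun m => AddMonoidAlgebra.single (p n • m.toAdd)
        (∏ j, alpha k j (n + 1) ^ (-(m.toAdd j)))
      map_one' := by simp [AddMonoidAlgebra.one_def]
      map_mul' := fun a b => by
        simp only [toAdd_mul, smul_add, Pi.add_apply, neg_add, AddMonoidAlgebra.single_mul_single]
        congr 1
        rw [← Finset.prod_mul_distrib]
        exact Finset.prod_congr rfl fun j _ => zpow_add₀ (alpha_ne_zero k j (n + 1)) _ _ }

/-- `φ_n` is indeed given on the variables by `t_{j,n} ↦ α_{j,n+1}⁻¹ t_{j,n+1} ^ p_n`. -/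
lemma step_t (k : Type u) [Field k] {d : ℕ} (p : ℕ → ℕ) (n : ℕ) (j : Fin d) :
    step k d p n (t k j n) = (alpha k j (n + 1))⁻¹ • t k j (n + 1) ^ p n := by
  rw [step, t, AddMonoidAlgebra.lift_single, one_smul, t, AddMonoidAlgebra.single_pow,
    AddMonoidAlgebra.smul_single]
  simp only [MonoidHom.coe_mk, OneHom.coe_mk, toAdd_ofAdd, one_pow, smul_eq_mul, mul_one]
  congr 1
  rw [Finset.prod_eq_single j]
  · simp
  · intro i _ hi
    simp [Pi.single_eq_of_ne hi]
  · simp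

/-- The composite `φ_{n-1} ∘ ⋯ ∘ φ_m : R_m → R_n` for `m ≤ n`. -/
noncomputable def trans (k : Type u) [Field k] (d : ℕ) (p : ℕ → ℕ) (m n : ℕ) (h : m ≤ n) :
    Level k d m →ₐ[Coeff k d] Level k d n :=
  Nat.leRec (motive := fun n _ => Level k d m →ₐ[Coeff k d] Level k d n)
    (AlgHom.id _ _) (fun n _ f => (step k d p n).comp f) h

lemma trans_self (k : Type u) [Field k] (d : ℕ) (p : ℕ → ℕ) (m : ℕ) :
    trans k d p m m le_rfl = AlgHom.id _ _ :=
  Nat.leRec_self _ _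

lemma trans_succ (k : Type u) [Field k] (d : ℕ) (p : ℕ → ℕ) {m n : ℕ} (h : m ≤ n) :
    trans k d p m (n + 1) (Nat.le_succ_of_le h) = (step k d p n).comp (trans k d p m n h) :=
  Nat.leRec_succ _ _ h

instance directedSystem (k : Type u) [Field k] (d : ℕ) (p : ℕ → ℕ) :
    DirectedSystem (Level k d) (trans k d p · · ·) where
  map_self m x := by rw [trans_self]; rfl
  map_map n l m hml hln x := by
    induction n, hln using Nat.le_induction with
    | base => rw [trans_self]; rfl
    | succ n hln ih =>
      rw [trans_succ k d p hln, trans_succ k d p (hml.trans hln), AlgHom.comp_apply,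
        AlgHom.comp_apply, ih]

/-- The ring `R(k,d)`: the direct limit of `R_0 → R_1 → R_2 → ⋯` along the maps `φ_n`. It is a
`K`-algebra. -/
abbrev Limit (k : Type u) [Field k] (d : ℕ) (p : ℕ → ℕ) : Type u :=
  DirectLimit (Level k d) (trans k d p)

/-- The degree in `ℚ^d` of the monomials of `R_n`: `deg(t_{j,n}) = e_j / (p_0 ⋯ p_{n-1})`. -/
def deg (d : ℕ) (p : ℕ → ℕ) (n : ℕ) (m : Fin d → ℤ) : Fin d → ℚ :=
  fun j => (m j : ℚ) / ∏ i ∈ Finset.range n, (p i : ℚ)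

/-- The homogeneous component of degree `g ∈ ℚ^d` of `R(k,d)`: the union over all `n` of the
images of the components of degree `g` of the `R_n`. -/
noncomputable def component (k : Type u) [Field k] (d : ℕ) (p : ℕ → ℕ) (g : Fin d → ℚ) :
    Submodule (Coeff k d) (Limit k d p) :=
  ⨆ n : ℕ, (AddMonoidAlgebra.gradeBy (Coeff k d) (deg d p n) g).map
    (DirectLimit.Module.of (Coeff k d) ℕ (Level k d) (trans k d p) n)

end LaurentTower

/-!
Everything rests on reading the relation `α_{j,n+1} t_{j,n} = t_{j,n+1} ^ p_n` backwards: it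
expresses `α_{j,n+1}` through the `t`'s. Hence `R(k,d)` is generated, up to denominators that are
invertible in it, by the `α_{j,0}` and all the `t_{j,n}`, and these are algebraically independent
over `k` (`fromPoly_injective`). So `R(k,d)` is a localization of a polynomial ring in infinitely
many variables. It is also integral over the Laurent polynomial ring `R_0`, which is Noetherian.
These two facts make it Noetherian
(`isNoetherianRing_of_isLocalization_mvPolynomial`): a prime ideal of a localized polynomial ring
is the directed union of the finitely generated primes spanned by its elements in finitely many
variables, and integrality over a Noetherian ring gives the ascending chain condition on primes,
so the prime itself is finitely generated.

The grading is the one of the group algebras `R_n`, carried to the limit. The degree map of each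
`R_n` is injective, so a nonzero homogeneous element is the image of a monomial with a nonzero
coefficient in `K`, hence a unit; this makes the limit a graded field with degree-zero part `K`.
The condition on the primes says that every degree in `ℚ^d` occurs.

A torsion-free group of finite rank embeds in some `ℚ^d` with `d > 0`. For a subgroup `H` of
`ℚ^d`, the subring `⨁_{i ∈ H} R_i` of `R = R(k,d)` has a complement in `R` that is a
submodule over it and is therefore Noetherian, and it inherits all the other properties.
-/

/-! ### Localizations of polynomial rings -/

namespace MvPolynomial

theorem isPrime_map_C {R σ : Type*} [CommRing R] (q : Ideal R) [q.IsPrime] :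
    (q.map (C : R →+* MvPolynomial σ R)).IsPrime := by
  rw [← Ideal.Quotient.isDomain_iff_prime]
  exact (quotientEquivQuotientMvPolynomial (σ := σ) q).symm.toRingEquiv.toMulEquiv.isDomain _

/-- A prime ideal in a subset of the variables stays prime in all the variables. -/
theorem isPrime_map_rename_subtype {R σ : Type*} [CommRing R] (s : Set σ)
    (q : Ideal (MvPolynomial s R)) [q.IsPrime] :
    (q.map (rename (R := R) ((↑) : s → σ))).IsPrime := by
  classical
  let e : MvPolynomial (↥sᶜ) (MvPolynomial s R) ≃ₐ[R] MvPolynomial σ R :=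
    (sumAlgEquiv R (↥sᶜ) s).symm.trans
      (renameEquiv R ((Equiv.sumComm _ _).trans (Equiv.Set.sumCompl s)))
  have he : (RingHomClass.toRingHom e).comp C =
      (rename (R := R) ((↑) : s → σ) : MvPolynomial s R →+* MvPolynomial σ R) := by
    refine ringHom_ext (fun r => ?_) (fun i => ?_) <;> simp [e]
  have := isPrime_map_C (σ := ↥sᶜ) q
  have h := Ideal.map_isPrime_of_equiv e
    (I := q.map (C : _ →+* MvPolynomial (↥sᶜ) (MvPolynomial s R)))
  have h2 : (q.map (C : _ →+* MvPolynomial (↥sᶜ) (MvPolynomial s R))).map e =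
      q.map (rename (R := R) ((↑) : s → σ)) := by
    change Ideal.map (RingHomClass.toRingHom e) _ = _
    rw [Ideal.map_map, he]; rfl
  rwa [← h2]

end MvPolynomial

/-- A localization `R` of a polynomial ring in arbitrarily many variables over a Noetherian ring is
Noetherian if it is integral over some Noetherian ring `A`. For a prime `P` of `R` and a finite
set `s` of variables, let `J s` be the ideal generated by the polynomials in `P` that involve only
the variables in `s`. It is finitely generated and prime, and `P` is the directed union of the
`J s`. By incomparability, a strict inclusion between two of them stays strict after contraction to
`A`, so the family has a largest member, which is `P`. Cohen's theorem concludes. -/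
theorem isNoetherianRing_of_isLocalization_mvPolynomial {k σ R A : Type*} [CommRing k]
    [IsNoetherianRing k] [CommRing R] [Algebra (MvPolynomial σ k) R]
    (M : Submonoid (MvPolynomial σ k)) [IsLocalization M R] [CommRing A] [IsNoetherianRing A]
    [Algebra A R] [Algebra.IsIntegral A R] : IsNoetherianRing R := by
  classical
  refine IsNoetherianRing.of_prime fun P hP => ?_
  let f : MvPolynomial σ k →+* R := algebraMap _ _
  let ι (s : Finset σ) : MvPolynomial (s : Set σ) k →+* MvPolynomial σ k :=
    (MvPolynomial.rename (Subtype.val)).toRingHom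
  let q (s : Finset σ) : Ideal (MvPolynomial (s : Set σ) k) := (P.comap f).comap (ι s)
  let J (s : Finset σ) : Ideal R := ((q s).map (ι s)).map f
  have hqle (s) : (q s).map (ι s) ≤ P.comap f := Ideal.map_comap_le
  have hM {m} (hm : m ∈ M) : m ∉ P.comap f := fun h =>
    hP.ne_top (Ideal.eq_top_of_isUnit_mem _ h (IsLocalization.map_units R ⟨m, hm⟩))
  have hJprime (s) : (J s).IsPrime := by
    refine IsLocalization.isPrime_of_isPrime_disjoint M R _ ?_ ?_
    · exact MvPolynomial.isPrime_map_rename_subtype (s : Set σ) (q s)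
    · exact Set.disjoint_left.mpr fun m hm h => hM hm (hqle s h)
  have hJP (s) : J s ≤ P := Ideal.map_le_iff_le_comap.mpr (hqle s)
  have hJfg (s) : (J s).FG := Ideal.FG.map (Ideal.FG.map (IsNoetherian.noetherian (q s)) (ι s)) f
  have hmem {b : MvPolynomial σ k} (hb : f b ∈ P) {s : Finset σ} (hs : b.vars ⊆ s) : f b ∈ J s := by
    obtain ⟨b', rfl⟩ := (MvPolynomial.mem_supported (R := k) (s := (s : Set σ))).mpr
      (by exact_mod_cast hs) |> fun h => by
        rw [MvPolynomial.supported_eq_range_rename] at h; exact h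
    exact Ideal.mem_map_of_mem f (Ideal.mem_map_of_mem (ι s) hb)
  have hmono {s t : Finset σ} (hst : s ⊆ t) : J s ≤ J t := by
    refine Ideal.map_le_iff_le_comap.mpr (Ideal.map_le_iff_le_comap.mpr fun x hx => ?_)
    refine hmem hx ?_
    refine subset_trans ?_ hst
    have := MvPolynomial.mem_supported (R := k) (s := (s : Set σ)) (p := ι s x) |>.mp
      (by rw [MvPolynomial.supported_eq_range_rename]; exact ⟨x, rfl⟩)
    exact_mod_cast this
  -- A member of the family `J` whose contraction to `A` is maximal.
  obtain ⟨_, ⟨s, rfl⟩, hs⟩ := (wellFounded_gt (α := Ideal A)).has_min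
    (Set.range fun s => (J s).comap (algebraMap A R)) ⟨_, ⟨∅, rfl⟩⟩
  have hJs (t) (hst : s ⊆ t) : J s = J t := by
    by_contra hne
    exact hs _ ⟨t, rfl⟩ (Ideal.IsIntegral.comap_lt_comap (lt_of_le_of_ne (hmono hst) hne))
  suffices P = J s by rw [this]; exact hJfg s
  refine le_antisymm (fun x hx => ?_) (hJP s)
  obtain ⟨⟨b, m⟩, hbm⟩ := IsLocalization.surj M x
  have hb : f b ∈ J s := by
    rw [hJs _ (Finset.subset_union_left (s₂ := b.vars))]
    exact hmem (hbm ▸ P.mul_mem_right _ hx) Finset.subset_union_right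
  rw [show f b = x * f m from hbm.symm] at hb
  exact ((hJprime s).mem_or_mem hb).resolve_right fun h => hM m.2 (hJP s h)

/-! ### The grading of the limit -/

namespace LaurentTower

open scoped DirectSum

variable (k : Type u) [Field k] (d : ℕ) (p : ℕ → ℕ)

/-- The canonical map from the `n`-th Laurent polynomial ring to the direct limit. -/
noncomputable def ofLevel (n : ℕ) : Level k d n →ₐ[Coeff k d] Limit k d p :=
  DirectLimit.Algebra.of (Level k d) (trans k d p) n

lemma ofLevel_trans {m n : ℕ} (h : m ≤ n) (x : Level k d m) :
    ofLevel k d p n (trans k d p m n h x) = ofLevel k d p m x :=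
  DirectLimit.Algebra.of_f (G := Level k d) (f := trans k d p) h x

lemma ofLevel_step (n : ℕ) (x : Level k d n) :
    ofLevel k d p (n + 1) (step k d p n x) = ofLevel k d p n x := by
  rw [← ofLevel_trans k d p (Nat.le_succ n), trans_succ k d p le_rfl, trans_self]
  rfl

lemma step_single (n : ℕ) (m : Fin d → ℤ) (c : Coeff k d) :
    step k d p n (AddMonoidAlgebra.single m c) =
      AddMonoidAlgebra.single (p n • m) (c * ∏ j, alpha k j (n + 1) ^ (-(m j))) := by
  rw [step, AddMonoidAlgebra.lift_single]
  simp [AddMonoidAlgebra.smul_single]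

lemma level_algHom_ext {B : Type*} [Semiring B] [Algebra (Coeff k d) B] {n : ℕ}
    {f g : Level k d n →ₐ[Coeff k d] B}
    (h : ∀ m, f (AddMonoidAlgebra.single m 1) = g (AddMonoidAlgebra.single m 1)) : f = g :=
  AddMonoidAlgebra.algHom_ext h (Algebra.ext_id _ _ _)

lemma exists_ofLevel (x : Limit k d p) : ∃ n y, x = ofLevel k d p n y :=
  DirectLimit.exists_eq_mk _ x

variable {p}

lemma deg_zero (n : ℕ) : deg d p n 0 = 0 := by
  ext; simp [deg]

lemma deg_add (n : ℕ) (a b : Fin d → ℤ) : deg d p n (a + b) = deg d p n a + deg d p n b := by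
  ext; simp [deg, add_div]

lemma prod_ne_zero (hp : ∀ i, p i ≠ 0) (n : ℕ) : ∏ i ∈ Finset.range n, (p i : ℚ) ≠ 0 :=
  Finset.prod_ne_zero_iff.mpr fun i _ => Nat.cast_ne_zero.mpr (hp i)

lemma deg_injective (hp : ∀ i, p i ≠ 0) (n : ℕ) : Function.Injective (deg d p n) := by
  intro a b h
  ext j
  have := congrFun h j
  simpa [deg, div_left_inj' (prod_ne_zero hp n)] using this

lemma deg_succ (hp : ∀ i, p i ≠ 0) (n : ℕ) (m : Fin d → ℤ) :
    deg d p (n + 1) (p n • m) = deg d p n m := by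
  ext j
  have h1 := prod_ne_zero hp n
  have h2 : (p n : ℚ) ≠ 0 := Nat.cast_ne_zero.mpr (hp n)
  simp only [deg, Finset.prod_range_succ, Pi.smul_apply, nsmul_eq_mul, Int.cast_mul,
    Int.cast_natCast]
  field_simp

/-- The part of degree `g` of the image of `R_n` in the limit. -/
noncomputable def levelComponent (p : ℕ → ℕ) (n : ℕ) (g : Fin d → ℚ) :
    Submodule (Coeff k d) (Limit k d p) :=
  (AddMonoidAlgebra.gradeBy (Coeff k d) (deg d p n) g).map (ofLevel k d p n).toLinearMap

lemma component_eq (g : Fin d → ℚ) : component k d p g = ⨆ n, levelComponent k d p n g := rfl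

/-- As `deg d p n` is injective, a homogeneous element of `R_n` is a single term. -/
lemma mem_levelComponent (hp : ∀ i, p i ≠ 0) {n : ℕ} {g : Fin d → ℚ} {x : Limit k d p} :
    x ∈ levelComponent k d p n g ↔
      x = 0 ∨ ∃ m c, deg d p n m = g ∧ x = ofLevel k d p n (AddMonoidAlgebra.single m c) := by
  constructor
  · rintro ⟨y, hy, rfl⟩
    by_cases hy0 : y = 0
    · simp [hy0]
    right
    have hy' := (AddMonoidAlgebra.mem_gradeBy_iff _ _ _ _).mp hy
    obtain ⟨m, hm⟩ : y.coeff.support.Nonempty := by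
      rw [Finsupp.support_nonempty_iff]
      simpa using hy0
    refine ⟨m, y.coeff m, hy' hm, congrArg _ ?_⟩
    ext m'
    rw [AddMonoidAlgebra.coeff_single]
    by_cases h : m = m'
    · simp [h]
    · rw [Finsupp.single_eq_of_ne (Ne.symm h)]
      by_contra h'
      exact h (deg_injective d hp n ((hy' hm).trans (hy' (Finsupp.mem_support_iff.mpr h')).symm))
  · rintro (rfl | ⟨m, c, rfl, rfl⟩)
    · exact zero_mem _
    · exact ⟨_, AddMonoidAlgebra.single_mem_gradeBy _ _ _, rfl⟩

lemma levelComponent_mono (hp : ∀ i, p i ≠ 0) (g : Fin d → ℚ) :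
    Monotone fun n => levelComponent k d p n g := by
  refine monotone_nat_of_le_succ fun n x hx => ?_
  rcases (mem_levelComponent k d hp).mp hx with rfl | ⟨m, c, rfl, rfl⟩
  · exact zero_mem _
  · refine (mem_levelComponent k d hp).mpr (.inr ⟨p n • m,
      c * ∏ j, alpha k j (n + 1) ^ (-(m j)), deg_succ d hp n m, ?_⟩)
    rw [← ofLevel_step, step_single]

lemma mem_component (hp : ∀ i, p i ≠ 0) {g : Fin d → ℚ} {x : Limit k d p} :
    x ∈ component k d p g ↔ ∃ n, x ∈ levelComponent k d p n g := by
  rw [component_eq]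
  exact Submodule.mem_iSup_of_directed _ (levelComponent_mono k d hp g).directed_le

lemma single_mem_component (n : ℕ) (m : Fin d → ℤ) (c : Coeff k d) :
    ofLevel k d p n (AddMonoidAlgebra.single m c) ∈ component k d p (deg d p n m) := by
  rw [component_eq]
  exact Submodule.mem_iSup_of_mem n
    ⟨AddMonoidAlgebra.single m c, AddMonoidAlgebra.single_mem_gradeBy _ _ _, rfl⟩

lemma gradedMonoid_component (hp : ∀ i, p i ≠ 0) :
    SetLike.GradedMonoid (component k d p) where
  one_mem := by
    have := single_mem_component k d (p := p) 0 0 1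
    rwa [← AddMonoidAlgebra.one_def, map_one, deg_zero]
      at this
  mul_mem g h x y hx hy := by
    obtain ⟨n₁, hx⟩ := (mem_component k d hp).mp hx
    obtain ⟨n₂, hy⟩ := (mem_component k d hp).mp hy
    rcases (mem_levelComponent k d hp).mp
      (levelComponent_mono k d hp g (le_max_left n₁ n₂) hx) with rfl | ⟨m, c, rfl, rfl⟩
    · rw [zero_mul]; exact zero_mem _
    rcases (mem_levelComponent k d hp).mp
      (levelComponent_mono k d hp h (le_max_right n₁ n₂) hy) with rfl | ⟨m', c', rfl, rfl⟩
    · rw [mul_zero]; exact zero_mem _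
    rw [← map_mul, AddMonoidAlgebra.single_mul_single, ← deg_add]
    exact single_mem_component k d _ _ _

/-- The decomposition of `R_n` by degrees, with values in the sum of the components of the
limit. -/
noncomputable def levelDecompose [SetLike.GradedMonoid (component k d p)] (n : ℕ) :
    Level k d n →ₐ[Coeff k d] ⨁ g, component k d p g :=
  AddMonoidAlgebra.lift (Coeff k d) _ (Fin d → ℤ)
    { toFun := fun m => DirectSum.of (fun g => component k d p g) (deg d p n m.toAdd)
        ⟨_, single_mem_component k d n m.toAdd 1⟩
      map_one' := by
        refine DirectSum.of_eq_of_gradedMonoid_eq (Sigma.subtype_ext ?_ ?_)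
        · exact deg_zero d n
        · exact map_one _
      map_mul' := fun a b => by
        rw [DirectSum.of_mul_of]
        refine DirectSum.of_eq_of_gradedMonoid_eq (Sigma.subtype_ext ?_ ?_)
        · exact deg_add d n _ _
        · change ofLevel k d p n _ = ofLevel k d p n _ * ofLevel k d p n _
          rw [← map_mul, AddMonoidAlgebra.single_mul_single, mul_one, toAdd_mul] }

lemma levelDecompose_single [SetLike.GradedMonoid (component k d p)] (n : ℕ) (m : Fin d → ℤ)
    (c : Coeff k d) :
    levelDecompose k d n (AddMonoidAlgebra.single m c) =
      DirectSum.of (fun g => component k d p g) (deg d p n m)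
        ⟨_, single_mem_component k d n m c⟩ := by
  rw [levelDecompose, AddMonoidAlgebra.lift_single]
  simp only [MonoidHom.coe_mk, OneHom.coe_mk, toAdd_ofAdd]
  change c • DirectSum.lof (Coeff k d) _ _ _ _ = DirectSum.lof (Coeff k d) _ _ _ _
  rw [← map_smul]
  congr 1
  ext
  simp [← map_smul, AddMonoidAlgebra.smul_single]

lemma levelDecompose_step [SetLike.GradedMonoid (component k d p)] (hp : ∀ i, p i ≠ 0) (n : ℕ) :
    (levelDecompose k d (p := p) (n + 1)).comp (step k d p n) = levelDecompose k d n := by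
  refine level_algHom_ext k d fun m => ?_
  rw [AlgHom.comp_apply, step_single, levelDecompose_single, levelDecompose_single]
  refine DirectSum.of_eq_of_gradedMonoid_eq (Sigma.subtype_ext ?_ ?_)
  · exact deg_succ d hp n m
  · change ofLevel k d p _ _ = ofLevel k d p _ _
    rw [← ofLevel_step k d p n (AddMonoidAlgebra.single m 1), step_single]

lemma levelDecompose_trans [SetLike.GradedMonoid (component k d p)] (hp : ∀ i, p i ≠ 0)
    {m n : ℕ} (h : m ≤ n) :
    (levelDecompose k d (p := p) n).comp (trans k d p m n h) = levelDecompose k d m := by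
  induction n, h using Nat.le_induction with
  | base => rw [trans_self]; rfl
  | succ n h ih => rw [trans_succ k d p h, ← AlgHom.comp_assoc, levelDecompose_step k d hp, ih]

/-- The grading of `R(k,d)` by `ℚ^d`. -/
@[reducible] noncomputable def gradedAlgebra (hp : ∀ i, p i ≠ 0) :
    GradedAlgebra (component k d p) :=
  letI := gradedMonoid_component k d hp
  GradedAlgebra.ofAlgHom (component k d p)
    (DirectLimit.Algebra.lift (Level k d) (trans k d p) _ (levelDecompose k d)
      fun _ _ h x => DFunLike.congr_fun (levelDecompose_trans k d hp h) x)
    (by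
      apply DirectLimit.Algebra.hom_ext
      refine fun n => level_algHom_ext k d fun m => ?_
      change DirectSum.coeAlgHom _ (levelDecompose k d n _) = ofLevel k d p n _
      rw [levelDecompose_single]
      exact DirectSum.coeAlgHom_of _ _ _)
    (fun g x => by
      obtain ⟨x, hx⟩ := x
      obtain ⟨n, hn⟩ := (mem_component k d hp).mp hx
      rcases (mem_levelComponent k d hp).mp hn with rfl | ⟨m, c, rfl, rfl⟩
      · rw [map_zero]; exact (map_zero _).symm
      · exact levelDecompose_single k d n m c)

end LaurentTower

/-! ### Homogeneous elements, degrees and integrality -/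

/-- A graded ring whose nonzero homogeneous elements are units is a graded field. -/
theorem isGradedField_of_isUnit {ι σ A : Type*} [DecidableEq ι] [AddCommGroup ι] [CommRing A]
    [Nontrivial A] [SetLike σ A] [AddSubgroupClass σ A] (𝒜 : ι → σ) [GradedRing 𝒜]
    (h : ∀ g, ∀ x ∈ 𝒜 g, x ≠ 0 → IsUnit x) : IsGradedField 𝒜 := by
  refine ⟨inferInstance, fun I hI => or_iff_not_imp_left.mpr fun hne => ?_⟩
  obtain ⟨x, hxI, hx⟩ := Submodule.exists_mem_ne_zero_of_ne_bot hne
  obtain ⟨g, hg⟩ : ∃ g, (DirectSum.decompose 𝒜 x g : A) ≠ 0 := by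
    by_contra! h0
    exact hx ((DirectSum.decompose 𝒜).injective (by ext g; simp [h0]))
  exact Ideal.eq_top_of_isUnit_mem _ (hI g hxI) (h g _ (SetLike.coe_mem _) hg)

namespace LaurentTower

variable (k : Type u) [Field k] (d : ℕ) {p : ℕ → ℕ}

lemma isUnit_single (n : ℕ) (m : Fin d → ℤ) {c : Coeff k d} (hc : c ≠ 0) :
    IsUnit (AddMonoidAlgebra.single m c : Level k d n) := by
  refine .of_mul_eq_one (AddMonoidAlgebra.single (-m) c⁻¹) ?_
  rw [AddMonoidAlgebra.single_mul_single, add_neg_cancel, mul_inv_cancel₀ hc,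
    AddMonoidAlgebra.one_def]

lemma isUnit_of_mem_component (hp : ∀ i, p i ≠ 0) {g : Fin d → ℚ} {x : Limit k d p}
    (hx : x ∈ component k d p g) (hx0 : x ≠ 0) : IsUnit x := by
  obtain ⟨n, hn⟩ := (mem_component k d hp).mp hx
  rcases (mem_levelComponent k d hp).mp hn with rfl | ⟨m, c, rfl, rfl⟩
  · exact absurd rfl hx0
  · refine (isUnit_single k d n m ?_).map (ofLevel k d p n)
    rintro rfl
    exact hx0 (by rw [AddMonoidAlgebra.single_zero, map_zero])

lemma ofLevel_single_zero (n : ℕ) (c : Coeff k d) :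
    ofLevel k d p n (AddMonoidAlgebra.single 0 c) = algebraMap (Coeff k d) (Limit k d p) c :=
  (ofLevel k d p n).commutes c

lemma ofLevel_single (n : ℕ) (m : Fin d → ℤ) (c : Coeff k d) :
    ofLevel k d p n (AddMonoidAlgebra.single m c) =
      algebraMap (Coeff k d) (Limit k d p) c * ofLevel k d p n (AddMonoidAlgebra.single m 1) := by
  rw [← ofLevel_single_zero k d n c, ← map_mul, AddMonoidAlgebra.single_mul_single, zero_add,
    mul_one]

lemma component_zero (hp : ∀ i, p i ≠ 0) :
    (component k d p 0 : Set (Limit k d p)) = Set.range (algebraMap (Coeff k d) _) := by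
  ext x
  constructor
  · intro hx
    obtain ⟨n, hn⟩ := (mem_component k d hp).mp hx
    rcases (mem_levelComponent k d hp).mp hn with rfl | ⟨m, c, hm, rfl⟩
    · exact ⟨0, map_zero _⟩
    · obtain rfl : m = 0 := deg_injective d hp n (hm.trans (deg_zero d n).symm)
      exact ⟨c, (ofLevel_single_zero k d n c).symm⟩
  · rintro ⟨c, rfl⟩
    have := single_mem_component k d (p := p) 0 0 c
    rwa [ofLevel_single_zero, deg_zero] at this

lemma exists_deg_eq (hp : ∀ i, p i ≠ 0)
    (hq : ∀ q : ℚ, ∃ (n : ℕ) (m : ℤ), q = (m : ℚ) / ∏ i ∈ Finset.range n, (p i : ℚ))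
    (g : Fin d → ℚ) : ∃ n m, deg d p n m = g := by
  choose n m h using fun j => hq (g j)
  let N := Finset.univ.sup n
  refine ⟨N, fun j => m j * ∏ i ∈ Finset.Ico (n j) N, (p i : ℤ), funext fun j => ?_⟩
  have hj : n j ≤ N := Finset.le_sup (Finset.mem_univ j)
  have h0 : ∏ i ∈ Finset.Ico (n j) N, (p i : ℚ) ≠ 0 :=
    Finset.prod_ne_zero_iff.mpr fun i _ => Nat.cast_ne_zero.mpr (hp i)
  simp only [deg]
  rw [← Finset.prod_range_mul_prod_Ico _ hj, h j]
  push_cast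
  exact mul_div_mul_right _ _ h0

lemma gradedSupport_component (hp : ∀ i, p i ≠ 0)
    (hq : ∀ q : ℚ, ∃ (n : ℕ) (m : ℤ), q = (m : ℚ) / ∏ i ∈ Finset.range n, (p i : ℚ)) :
    gradedSupport (component k d p) = Set.univ := by
  refine Set.eq_univ_of_forall fun g => ?_
  obtain ⟨n, m, rfl⟩ := exists_deg_eq d hp hq g
  exact ⟨_, single_mem_component k d n m 1,
    ((isUnit_single k d n m one_ne_zero).map (ofLevel k d p n)).ne_zero⟩

instance isNoetherianRing_level (n : ℕ) : IsNoetherianRing (Level k d n) :=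
  Algebra.FiniteType.isNoetherianRing (Coeff k d) _

/-- The limit is integral over `R_0`: a power of a monomial of `R_{n+1}` comes from `R_n`. -/
lemma ofLevel_zero_isIntegral (hp : ∀ i, p i ≠ 0) :
    (ofLevel k d p 0 : Level k d 0 →+* Limit k d p).IsIntegral := by
  have key (n : ℕ) : ∀ m c, (ofLevel k d p 0 : Level k d 0 →+* Limit k d p).IsIntegralElem
      (ofLevel k d p n (AddMonoidAlgebra.single m c)) := by
    let := (ofLevel k d p 0 : Level k d 0 →+* Limit k d p).toAlgebra
    induction n with
    | zero => exact fun m c => RingHom.isIntegralElem_map _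
    | succ n ih =>
      intro m c
      have h : ofLevel k d p (n + 1) (AddMonoidAlgebra.single m c) ^ p n =
          ofLevel k d p n
            (AddMonoidAlgebra.single m (c ^ p n * ∏ j, alpha k j (n + 1) ^ (m j))) := by
        rw [← map_pow, AddMonoidAlgebra.single_pow, ← ofLevel_step k d p n, step_single, mul_assoc,
          ← Finset.prod_mul_distrib]
        congr 2
        rw [Finset.prod_eq_one, mul_one]
        intro j _
        rw [← zpow_add₀ (alpha_ne_zero k j _), add_neg_cancel, zpow_zero]
      exact IsIntegral.of_pow (R := Level k d 0) (Nat.pos_of_ne_zero (hp n)) (h ▸ ih _ _)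
  intro x
  obtain ⟨n, y, rfl⟩ := exists_ofLevel k d p x
  induction y using AddMonoidAlgebra.induction_linear with
  | zero => rw [map_zero]; exact RingHom.isIntegralElem_zero _
  | add f g hf hg => rw [map_add]; exact hf.add _ hg
  | single m c => exact key n m c

end LaurentTower

/-! ### The limit as a localization of a polynomial ring -/

namespace LaurentTower

variable (k : Type u) [Field k] (d : ℕ) (p : ℕ → ℕ)

/-- Index set for the indeterminates `α_{j,0}` (left summand) and `t_{j,n}` (right summand). -/
abbrev Var (d : ℕ) : Type := Fin d ⊕ Fin d × ℕ

/-- The variable `t_{j,n}` in the limit. -/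
noncomputable def tLim (j : Fin d) (n : ℕ) : Limit k d p := ofLevel k d p n (t k j n)

lemma isUnit_tLim (j : Fin d) (n : ℕ) : IsUnit (tLim k d p j n) :=
  (isUnit_single k d n _ one_ne_zero).map (ofLevel k d p n)

lemma alpha_mul_tLim (j : Fin d) (n : ℕ) :
    algebraMap (Coeff k d) (Limit k d p) (alpha k j (n + 1)) * tLim k d p j n =
      tLim k d p j (n + 1) ^ p n := by
  rw [tLim, ← ofLevel_step, step_t, map_smul, map_pow, Algebra.smul_def, ← mul_assoc, ← map_mul,
    mul_inv_cancel₀ (alpha_ne_zero k j _), map_one, one_mul, tLim]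

/-- The map from the polynomial ring in the `α_{j,0}` and all the `t_{j,n}` to the limit. -/
noncomputable def fromPoly : MvPolynomial (Var d) k →+* Limit k d p :=
  MvPolynomial.eval₂Hom ((algebraMap (Coeff k d) (Limit k d p)).comp (algebraMap k (Coeff k d)))
    (Sum.elim (fun j => algebraMap _ _ (alpha k j 0)) (fun x => tLim k d p x.1 x.2))

end LaurentTower

/-- The subring of fractions in `R` whose numerator and denominator lie in the image of `f`, the
denominator being invertible in `R`. -/
def RingHom.fractionSubring {B R : Type*} [CommRing B] [CommRing R] (f : B →+* R) : Subring R where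
  carrier := {x | ∃ a b, IsUnit (f b) ∧ x * f b = f a}
  zero_mem' := ⟨0, 1, by simp, by simp⟩
  one_mem' := ⟨1, 1, by simp, by simp⟩
  neg_mem' := by
    rintro x ⟨a, b, hb, h⟩
    exact ⟨-a, b, hb, by rw [neg_mul, h, map_neg]⟩
  add_mem' := by
    rintro x y ⟨a, b, hb, h⟩ ⟨a', b', hb', h'⟩
    refine ⟨a * b' + a' * b, b * b', by rw [map_mul]; exact hb.mul hb', ?_⟩
    simp only [map_mul, map_add, ← h, ← h']
    ring
  mul_mem' := by
    rintro x y ⟨a, b, hb, h⟩ ⟨a', b', hb', h'⟩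
    refine ⟨a * a', b * b', by rw [map_mul]; exact hb.mul hb', ?_⟩
    simp only [map_mul, ← h, ← h']
    ring

namespace RingHom

variable {B R : Type*} [CommRing B] [CommRing R] (f : B →+* R)

lemma apply_mem_fractionSubring (a : B) : f a ∈ f.fractionSubring := ⟨a, 1, by simp, by simp⟩

lemma mem_fractionSubring_of_mul_eq_one {x y : R} (hx : x ∈ f.fractionSubring) (hxy : x * y = 1) :
    y ∈ f.fractionSubring := by
  obtain ⟨a, b, hb, h⟩ := hx
  refine ⟨b, a, ?_, ?_⟩
  · rw [← h]
    exact (IsUnit.of_mul_eq_one y hxy).mul hb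
  · rw [← h, ← mul_assoc, mul_comm y, hxy, one_mul]

end RingHom

namespace LaurentTower

variable (k : Type u) [Field k] (d : ℕ) (p : ℕ → ℕ)

lemma tLim_mem (j : Fin d) (n : ℕ) : tLim k d p j n ∈ (fromPoly k d p).fractionSubring := by
  have := (fromPoly k d p).apply_mem_fractionSubring (.X (.inr (j, n)))
  simpa [fromPoly] using this

lemma alpha_mem (j : Fin d) (n : ℕ) :
    algebraMap (Coeff k d) (Limit k d p) (alpha k j n) ∈ (fromPoly k d p).fractionSubring := by
  cases n with
  | zero =>
    have := (fromPoly k d p).apply_mem_fractionSubring (.X (.inl j))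
    simpa [fromPoly] using this
  | succ n =>
    obtain ⟨y, hy⟩ := (isUnit_tLim k d p j n).exists_right_inv
    have := mul_mem (pow_mem (tLim_mem k d p j (n + 1)) (p n))
      ((fromPoly k d p).mem_fractionSubring_of_mul_eq_one (tLim_mem k d p j n) hy)
    rwa [← alpha_mul_tLim, mul_assoc, hy, mul_one] at this

lemma algebraMap_mem (c : Coeff k d) :
    algebraMap (Coeff k d) (Limit k d p) c ∈ (fromPoly k d p).fractionSubring := by
  have hpoly (f : MvPolynomial (Fin d × ℕ) k) :
      algebraMap (Coeff k d) (Limit k d p) (algebraMap _ _ f) ∈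
        (fromPoly k d p).fractionSubring := by
    induction f using MvPolynomial.induction_on with
    | C a =>
      have := (fromPoly k d p).apply_mem_fractionSubring (.C a)
      rwa [fromPoly, MvPolynomial.eval₂Hom_C] at this
    | add f g hf hg => rw [map_add, map_add]; exact add_mem hf hg
    | mul_X f x hf => rw [map_mul, map_mul]; exact mul_mem hf (alpha_mem k d p x.1 x.2)
  obtain ⟨a, b, hb, rfl⟩ := IsFractionRing.div_surjective (A := MvPolynomial (Fin d × ℕ) k) c
  rw [div_eq_mul_inv, map_mul]
  refine mul_mem (hpoly a) ((fromPoly k d p).mem_fractionSubring_of_mul_eq_one (hpoly b) ?_)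
  rw [← map_mul, mul_inv_cancel₀ (IsFractionRing.to_map_ne_zero_of_mem_nonZeroDivisors hb), map_one]

lemma single_mem (n : ℕ) (m : Fin d → ℤ) :
    ofLevel k d p n (AddMonoidAlgebra.single m 1) ∈ (fromPoly k d p).fractionSubring := by
  let H : AddSubgroup (Fin d → ℤ) :=
    { carrier := {m | ofLevel k d p n (AddMonoidAlgebra.single m 1) ∈
        (fromPoly k d p).fractionSubring}
      zero_mem' := by
        rw [Set.mem_ofPred_eq, ← AddMonoidAlgebra.one_def, map_one]; exact one_mem _
      add_mem' := fun {a b} ha hb => by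
        rw [Set.mem_ofPred_eq] at ha hb ⊢
        have := mul_mem ha hb
        rwa [← map_mul, AddMonoidAlgebra.single_mul_single, mul_one] at this
      neg_mem' := fun {a} ha => by
        rw [Set.mem_ofPred_eq] at ha ⊢
        refine (fromPoly k d p).mem_fractionSubring_of_mul_eq_one ha ?_
        rw [← map_mul, AddMonoidAlgebra.single_mul_single, mul_one, add_neg_cancel,
          ← AddMonoidAlgebra.one_def, map_one] }
  have hm : m = ∑ j, m j • (Pi.single j 1 : Fin d → ℤ) := by
    ext i; simp [Finset.sum_apply, Pi.single_apply]
  change m ∈ H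
  rw [hm]
  exact sum_mem fun j _ => H.zsmul_mem (show Pi.single j 1 ∈ H from tLim_mem k d p j n) _

/-- The limit consists of fractions of polynomials in the `α_{j,0}` and `t_{j,n}`: the relation
`alpha_mul_tLim` expresses the other `α_{j,n+1}` through these. -/
lemma fractionSubring_eq_top : (fromPoly k d p).fractionSubring = ⊤ := by
  refine (Subring.eq_top_iff' _).mpr fun x => ?_
  obtain ⟨n, y, rfl⟩ := exists_ofLevel k d p x
  induction y using AddMonoidAlgebra.induction_linear with
  | zero => rw [map_zero]; exact zero_mem _
  | add f g hf hg => rw [map_add]; exact add_mem hf hg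
  | single m c => rw [ofLevel_single]; exact mul_mem (algebraMap_mem k d p c) (single_mem k d p n m)

/-- The structure map `K → L` of a field `L` extends to the limit by any nonzero values for the
`t_{j,n}` that satisfy the relations `α_{j,n+1} t_{j,n} = t_{j,n+1} ^ p_n`. -/
lemma exists_algHom_limit {L : Type*} [Field L] [Algebra (Coeff k d) L] (τ : Fin d → ℕ → L)
    (hτ : ∀ j n, τ j n ≠ 0)
    (h : ∀ j n, algebraMap (Coeff k d) L (alpha k j (n + 1)) * τ j n = τ j (n + 1) ^ p n) :
    ∃ θ : Limit k d p →ₐ[Coeff k d] L, ∀ j n, θ (tLim k d p j n) = τ j n := by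
  let F (n : ℕ) : Level k d n →ₐ[Coeff k d] L := AddMonoidAlgebra.lift (Coeff k d) L (Fin d → ℤ)
    { toFun := fun m => ∏ j, τ j n ^ (m.toAdd j)
      map_one' := by simp
      map_mul' := fun a b => by
        rw [← Finset.prod_mul_distrib]
        exact Finset.prod_congr rfl fun j _ => zpow_add₀ (hτ j n) _ _ }
  have hF (n m) : F n (AddMonoidAlgebra.single m 1) = ∏ j, τ j n ^ (m j) := by
    simp only [F, AddMonoidAlgebra.lift_single, one_smul]; rfl
  have hstep (n) : (F (n + 1)).comp (step k d p n) = F n := by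
    refine level_algHom_ext k d fun m => ?_
    rw [AlgHom.comp_apply, step_single, one_mul, ← mul_one (∏ j, alpha k j (n + 1) ^ (-(m j))),
      ← smul_eq_mul, ← AddMonoidAlgebra.smul_single, map_smul, hF, hF, Algebra.smul_def, map_prod,
      ← Finset.prod_mul_distrib]
    refine Finset.prod_congr rfl fun j _ => ?_
    have hα : algebraMap (Coeff k d) L (alpha k j (n + 1)) ≠ 0 := by simp [alpha_ne_zero]
    rw [map_zpow₀, Pi.smul_apply, nsmul_eq_mul, zpow_mul, zpow_natCast, ← h, mul_zpow, ← mul_assoc,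
      ← zpow_add₀ hα, neg_add_cancel, zpow_zero, one_mul]
  have htrans {m n : ℕ} (hmn : m ≤ n) : (F n).comp (trans k d p m n hmn) = F m := by
    induction n, hmn using Nat.le_induction with
    | base => rw [trans_self]; rfl
    | succ n hmn ih => rw [trans_succ k d p hmn, ← AlgHom.comp_assoc, hstep, ih]
  refine ⟨DirectLimit.Algebra.lift (Level k d) (trans k d p) _ F
    fun _ _ hij x => DFunLike.congr_fun (htrans hij) x, fun j n => ?_⟩
  refine (hF n _).trans ?_
  rw [Finset.prod_eq_single j]
  · simp
  · intro i _ hi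
    simp [Pi.single_eq_of_ne hi]
  · simp

/-- The exponent of the Laurent monomial in the `α_{j,0}` and `t_{j,n}` that is equal to `α_{j,n}`:
`α_{j,n+1} = t_{j,n+1} ^ p_n * t_{j,n}⁻¹`. -/
noncomputable def alphaExponent : Fin d × ℕ → (Var d →₀ ℤ)
  | (j, 0) => Finsupp.single (.inl j) 1
  | (j, n + 1) => Finsupp.single (.inr (j, n + 1)) (p n : ℤ) - Finsupp.single (.inr (j, n)) 1

/-- The coefficients of a combination of the exponents of the `α_{j,n}` can be recovered one after
the other: for fixed `j`, the system of equations is triangular in `n`. -/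
lemma linearIndependent_alphaExponent : LinearIndependent ℕ (alphaExponent d p) := by
  have h0 (e : Fin d × ℕ →₀ ℕ) (j) :
      Finsupp.linearCombination ℕ (alphaExponent d p) e (.inl j) = e (j, 0) := by
    induction e using Finsupp.induction_linear with
    | zero => simp
    | add f g hf hg => simp [hf, hg]
    | single x n =>
      obtain ⟨i, _ | l⟩ := x <;> simp [alphaExponent, Finsupp.single_apply]
  have h1 (e : Fin d × ℕ →₀ ℕ) (j) :
      Finsupp.linearCombination ℕ (alphaExponent d p) e (.inr (j, 0)) = -(e (j, 1) : ℤ) := by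
    induction e using Finsupp.induction_linear with
    | zero => simp
    | add f g hf hg => simp [hf, hg]; ring
    | single x n =>
      obtain ⟨i, _ | l⟩ := x <;> simp [alphaExponent, Finsupp.single_apply]
  have h2 (e : Fin d × ℕ →₀ ℕ) (j i) :
      Finsupp.linearCombination ℕ (alphaExponent d p) e (.inr (j, i + 1)) =
        (p i * e (j, i + 1) - e (j, i + 2) : ℤ) := by
    induction e using Finsupp.induction_linear with
    | zero => simp
    | add f g hf hg => simp [hf, hg]; ring
    | single x n =>
      obtain ⟨i', _ | l⟩ := x
      · simp [alphaExponent]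
      · simp [alphaExponent, Finsupp.single_apply]
        by_cases h : i' = j ∧ l = i
        · obtain ⟨rfl, rfl⟩ := h
          simp [mul_comm]
        · simp [h]
  intro e e' h
  have hs (j) : ∀ i, e (j, i) = e' (j, i) := by
    intro i
    induction i using Nat.strong_induction_on with
    | _ i ih =>
      match i with
      | 0 => exact_mod_cast (h0 e j).symm.trans ((DFunLike.congr_fun h _).trans (h0 e' j))
      | 1 => simpa using (h1 e j).symm.trans ((DFunLike.congr_fun h _).trans (h1 e' j))
      | i + 2 =>
        have := (h2 e j i).symm.trans ((DFunLike.congr_fun h _).trans (h2 e' j i))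
        rw [ih (i + 1) (by omega)] at this
        omega
  ext ⟨j, i⟩
  exact hs j i

/-- The `α_{j,0}` and `t_{j,n}` are algebraically independent over `k`. A map from the limit to the
fraction field `L` of the ring of Laurent polynomials in the `α_{j,0}` and `t_{j,n}` is defined by
`α_{j,n+1} ↦ t_{j,n+1} ^ p_n / t_{j,n}`; its composite with `fromPoly` is the inclusion. -/
lemma fromPoly_injective : Function.Injective (fromPoly k d p) := by
  let W := AddMonoidAlgebra k (Var d →₀ ℤ)
  let L := FractionRing W
  let w (s : Var d) : L := algebraMap W L (AddMonoidAlgebra.single (Finsupp.single s 1) 1)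
  have hW : Function.Injective (algebraMap W L) := IsFractionRing.injective W L
  let T₁ : (Fin d × ℕ →₀ ℕ) →+ (Var d →₀ ℤ) :=
    (Finsupp.linearCombination ℕ (alphaExponent d p)).toAddMonoidHom
  let T₂ : (Var d →₀ ℕ) →+ (Var d →₀ ℤ) := Finsupp.mapRange.addMonoidHom (Nat.castAddMonoidHom ℤ)
  -- Both homomorphisms send monomials to monomials along an injective map of exponents, so they
  -- are injective.
  let φ₁ : MvPolynomial (Fin d × ℕ) k →+* L :=
    (algebraMap W L).comp (AddMonoidAlgebra.mapDomainRingHom k T₁)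
  let φ₂ : MvPolynomial (Var d) k →+* L :=
    (algebraMap W L).comp (AddMonoidAlgebra.mapDomainRingHom k T₂)
  have hφ₁ : Function.Injective φ₁ :=
    hW.comp (AddMonoidAlgebra.mapDomain_injective (linearIndependent_alphaExponent d p))
  have hφ₂ : Function.Injective φ₂ :=
    hW.comp (AddMonoidAlgebra.mapDomain_injective
      (Finsupp.mapRange_injective _ (by simp) Nat.cast_injective))
  have hX₁ (x) : φ₁ (.X x) =
      algebraMap W L (AddMonoidAlgebra.single (alphaExponent d p x) 1) := by
    change algebraMap W L (AddMonoidAlgebra.mapDomain T₁ (AddMonoidAlgebra.single _ _)) = _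
    rw [AddMonoidAlgebra.mapDomain_single]
    simp [T₁]
  have hX₂ (x) : φ₂ (.X x) = w x := by
    change algebraMap W L (AddMonoidAlgebra.mapDomain T₂ (AddMonoidAlgebra.single _ _)) = _
    rw [AddMonoidAlgebra.mapDomain_single]
    simp [T₂, w]
  have hC (a : k) : φ₁ (.C a) = φ₂ (.C a) := by
    change algebraMap W L (AddMonoidAlgebra.mapDomain T₁ (AddMonoidAlgebra.single _ _)) =
      algebraMap W L (AddMonoidAlgebra.mapDomain T₂ (AddMonoidAlgebra.single _ _))
    rw [AddMonoidAlgebra.mapDomain_single, AddMonoidAlgebra.mapDomain_single, map_zero, map_zero]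
  let : Algebra (Coeff k d) L := (IsFractionRing.lift hφ₁).toAlgebra
  have hK (f : MvPolynomial (Fin d × ℕ) k) :
      algebraMap (Coeff k d) L (algebraMap _ (Coeff k d) f) = φ₁ f :=
    IsFractionRing.lift_algebraMap hφ₁ f
  have hw (s) : w s ≠ 0 := by
    rw [← hX₂]
    exact (map_ne_zero_iff _ hφ₂).mpr (MvPolynomial.X_ne_zero s)
  obtain ⟨θ, hθ⟩ := exists_algHom_limit k d p (fun j n => w (.inr (j, n))) (fun j n => hw _)
    (fun j n => by
      rw [alpha, hK, hX₁, ← map_mul, ← map_pow, AddMonoidAlgebra.single_mul_single,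
        AddMonoidAlgebra.single_pow]
      simp [alphaExponent])
  have hcomp : (θ : Limit k d p →+* L).comp (fromPoly k d p) = φ₂ := by
    refine MvPolynomial.ringHom_ext (fun a => ?_) (fun s => ?_)
    · rw [RingHom.comp_apply, fromPoly, MvPolynomial.eval₂Hom_C, RingHom.comp_apply]
      refine (θ.commutes _).trans ?_
      rw [← hC, ← hK]
      rfl
    · rw [RingHom.comp_apply, fromPoly, MvPolynomial.eval₂Hom_X', hX₂]
      rcases s with j | ⟨j, n⟩
      · refine (θ.commutes _).trans ?_
        rw [alpha, hK, hX₁]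
        rfl
      · exact hθ j n
  exact .of_comp (f := θ) (by rw [← RingHom.coe_coe, ← RingHom.coe_comp, hcomp]; exact hφ₂)

theorem isNoetherianRing_limit (hp : ∀ i, p i ≠ 0) : IsNoetherianRing (Limit k d p) := by
  let : Algebra (MvPolynomial (Var d) k) (Limit k d p) := (fromPoly k d p).toAlgebra
  let : Algebra (Level k d 0) (Limit k d p) :=
    (ofLevel k d p 0 : Level k d 0 →+* Limit k d p).toAlgebra
  have : Algebra.IsIntegral (Level k d 0) (Limit k d p) := ⟨ofLevel_zero_isIntegral k d hp⟩
  -- The limit is the localization of the polynomial ring at all that becomes invertible in it.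
  let M : Submonoid (MvPolynomial (Var d) k) :=
    (IsUnit.submonoid (Limit k d p)).comap (fromPoly k d p)
  have : IsLocalization M (Limit k d p) :=
    { map_units := fun m => m.2
      surj := fun x => by
        obtain ⟨a, b, hb, h⟩ := (fractionSubring_eq_top k d p).symm ▸ Subring.mem_top x
        exact ⟨(a, ⟨b, hb⟩), h⟩
      exists_of_eq := fun {a b} h => ⟨1, by rw [fromPoly_injective k d p h]⟩ }
  exact isNoetherianRing_of_isLocalization_mvPolynomial M (R := Limit k d p) (A := Level k d 0)

end LaurentTower

/-! ### Sequences of primes, groups of finite rank, and subgroups of the degree group -/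

/-- If every prime is listed infinitely often, every positive integer divides some partial
product. -/
theorem exists_prime_seq : ∃ p : ℕ → ℕ, (∀ i, (p i).Prime) ∧
    ∀ q : ℚ, ∃ (n : ℕ) (m : ℤ), q = (m : ℚ) / ∏ i ∈ Finset.range n, (p i : ℚ) := by
  let p : ℕ → ℕ := fun i => Nat.nth Nat.Prime i.unpair.1
  have hp (i) : (p i).Prime := Nat.nth_mem_of_infinite Nat.infinite_setOfPred_prime _
  have hp_surj (q : ℕ) (hq : q.Prime) (N : ℕ) : ∃ i, N ≤ i ∧ p i = q := by
    refine ⟨Nat.pair (Nat.primeCounting' q) N, Nat.right_le_pair _ _, ?_⟩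
    simp only [p, Nat.unpair_pair]
    exact Nat.nth_count hq
  have hdvd (D : ℕ) : D ≠ 0 → ∀ N, ∃ n, N ≤ n ∧ D ∣ ∏ i ∈ Finset.Ico N n, p i := by
    induction D using induction_on_primes with
    | zero => exact fun h => absurd rfl h
    | one => exact fun _ N => ⟨N, le_rfl, one_dvd _⟩
    | prime_mul q a hq ih =>
      intro h N
      obtain ⟨i, hi, rfl⟩ := hp_surj q hq N
      obtain ⟨n, hn, ha⟩ := ih (right_ne_zero_of_mul h) (i + 1)
      refine ⟨n, by omega, (mul_dvd_mul_left _ ha).trans ?_⟩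
      rw [← Finset.prod_eq_prod_Ico_succ_bot (by omega)]
      exact Finset.prod_dvd_prod_of_subset _ _ _ (Finset.Ico_subset_Ico_left hi)
  refine ⟨p, hp, fun q => ?_⟩
  obtain ⟨n, -, c, hc⟩ := hdvd q.den q.den_ne_zero 0
  rw [← Finset.range_eq_Ico] at hc
  refine ⟨n, q.num * c, ?_⟩
  have h0 : ∏ i ∈ Finset.range n, p i ≠ 0 := Finset.prod_ne_zero_iff.mpr fun i _ => (hp i).ne_zero
  have hc0 : (c : ℚ) ≠ 0 := Nat.cast_ne_zero.mpr (right_ne_zero_of_mul (hc ▸ h0))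
  rw [← Nat.cast_prod, hc]
  push_cast
  rw [mul_div_mul_right _ _ hc0, Rat.num_div_den]

open TensorProduct in
/-- A torsion-free group of finite rank embeds in `ℚ^(d+1)` for some `d`. The exponent is kept
positive so that the field `K` belonging to it has infinitely many indeterminates. -/
theorem exists_injective_of_rank_lt_aleph0 (G : Type*) [AddCommGroup G] [IsAddTorsionFree G]
    (h : Module.rank ℤ G < Cardinal.aleph0) :
    ∃ (d : ℕ) (φ : G →+ (Fin (d + 1) → ℚ)), Function.Injective φ := by
  have hrank := (TensorProduct.isBaseChange ℤ G ℚ).lift_rank_eq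
  rw [Cardinal.lift_inj] at hrank
  have : Module.Finite ℚ (ℚ ⊗[ℤ] G) := Module.rank_lt_aleph0_iff.mp (hrank ▸ h)
  let e := (Module.finBasis ℚ (ℚ ⊗[ℤ] G)).equivFun
  have hinj : Function.Injective (TensorProduct.mk ℤ ℚ G 1) := by
    have h1 := Module.Flat.rTensor_preserves_injective_linearMap (M := G)
      (Algebra.linearMap ℤ ℚ) Int.cast_injective
    have h2 := h1.comp (TensorProduct.lid ℤ G).symm.injective
    convert h2 using 1
    ext g
    simp
  let c {d : ℕ} : (Fin d → ℚ) →+ (Fin (d + 1) → ℚ) :=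
    { toFun := Fin.cons (α := fun _ => ℚ) 0
      map_zero' := by ext i; refine Fin.cases ?_ (fun _ => ?_) i <;> simp
      map_add' := fun a b => by ext i; refine Fin.cases ?_ (fun _ => ?_) i <;> simp }
  refine ⟨_, c.comp (e.toLinearMap.toAddMonoidHom.comp
    (TensorProduct.mk ℤ ℚ G 1 : G →+ ℚ ⊗[ℤ] G)), ?_⟩
  exact (Fin.cons_right_injective (α := fun _ => ℚ) 0).comp (e.injective.comp hinj)

/-- A subring `S` of a Noetherian ring that has an `S`-stable complement `C` is Noetherian: every
ideal of `S` is the contraction of its extension. -/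
theorem Subalgebra.isNoetherianRing_of_complement {K R : Type*} [CommRing K] [CommRing R]
    [IsNoetherianRing R] [Algebra K R] (S : Subalgebra K R) (C : Submodule K R)
    (hsup : ∀ r, ∃ s ∈ S, ∃ c ∈ C, r = s + c) (hdisj : ∀ x ∈ S, x ∈ C → x = 0)
    (hmul : ∀ s ∈ S, ∀ c ∈ C, s * c ∈ C) : IsNoetherianRing S := by
  have key (I : Ideal S) : (I.map S.val).comap S.val = I := by
    refine le_antisymm (fun x hx => ?_) Ideal.le_comap_map
    -- The statement is made for all multiples of `y` since `C` is stable under `S` only, not `R`.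
    have h (y) (hy : y ∈ I.map S.val) : ∀ r, ∃ a ∈ I, r * y - (a : R) ∈ C := by
      induction hy using Submodule.span_induction with
      | mem y hy =>
        intro r
        obtain ⟨a, ha, rfl⟩ := hy
        obtain ⟨s, hs, c, hc, rfl⟩ := hsup r
        refine ⟨⟨s, hs⟩ * a, I.mul_mem_left _ ha, ?_⟩
        have : (s + c) * (a : R) - s * a = a * c := by ring
        exact this ▸ hmul a a.2 c hc
      | zero => exact fun r => ⟨0, zero_mem _, by simp⟩
      | add y z _ _ hy hz =>
        intro r
        obtain ⟨a, ha, hya⟩ := hy r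
        obtain ⟨b, hb, hzb⟩ := hz r
        refine ⟨a + b, add_mem ha hb, ?_⟩
        have := add_mem hya hzb
        rw [AddMemClass.coe_add]
        convert this using 1
        ring
      | smul r' y _ hy =>
        intro r
        rw [smul_eq_mul, ← mul_assoc]
        exact hy _
    obtain ⟨a, ha, hxa⟩ := h _ hx 1
    rw [one_mul] at hxa
    have : x - a = 0 := Subtype.ext (hdisj _ (x - a).2 hxa)
    rwa [sub_eq_zero.mp this]
  have hmono : StrictMono (fun I : Ideal S => I.map S.val) :=
    Monotone.strictMono_of_injective (fun _ _ h => Ideal.map_mono h)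
      (Function.LeftInverse.injective key)
  exact isNoetherian_iff'.mpr hmono.wellFoundedGT

section Restrict

variable {K R ι : Type*} [CommRing K] [CommRing R] [Algebra K R] [AddCommGroup ι] [DecidableEq ι]
  (𝒜 : ι → Submodule K R) [GradedAlgebra 𝒜]

open DirectSum

/-- The elements of a graded ring all of whose nonzero homogeneous components have degree in
`s`. -/
def gradedPart (s : Set ι) : Submodule K R where
  carrier := {x | ∀ i, (decompose 𝒜 x i : R) ≠ 0 → i ∈ s}
  zero_mem' i := by simp
  add_mem' {x y} hx hy i h := by
    by_contra hi
    have h1 := not_imp_comm.mp (hx i) hi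
    have h2 := not_imp_comm.mp (hy i) hi
    simp [h1, h2] at h
  smul_mem' c x hx i h := by
    by_contra hi
    have h1 := not_imp_comm.mp (hx i) hi
    have h2 : (decompose 𝒜 (c • x) i : R) = c • (decompose 𝒜 x i : R) := by
      rw [decompose_smul]; rfl
    exact h (by rw [h2, h1, smul_zero])

variable {𝒜}

lemma mem_gradedPart_of_mem {s : Set ι} {i : ι} (hi : i ∈ s) {x : R} (hx : x ∈ 𝒜 i) :
    x ∈ gradedPart 𝒜 s := by
  intro j hj
  by_cases h : i = j
  · exact h ▸ hi
  · exact absurd (decompose_of_mem_ne 𝒜 hx h) hj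

lemma mem_of_mem_support_decompose [∀ i (x : 𝒜 i), Decidable (x ≠ 0)] {s : Set ι} {x : R}
    (hx : x ∈ gradedPart 𝒜 s) {i : ι} (hi : i ∈ (decompose 𝒜 x).support) : i ∈ s :=
  hx i (by simpa using hi)

lemma mul_mem_gradedPart {s t u : Set ι} (h : ∀ i ∈ s, ∀ j ∈ t, i + j ∈ u) {x y : R}
    (hx : x ∈ gradedPart 𝒜 s) (hy : y ∈ gradedPart 𝒜 t) : x * y ∈ gradedPart 𝒜 u := by
  classical
  rw [← sum_support_decompose 𝒜 x, ← sum_support_decompose 𝒜 y, Finset.sum_mul_sum]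
  refine sum_mem fun i hi => sum_mem fun j hj => mem_gradedPart_of_mem
    (h i (mem_of_mem_support_decompose hx hi) j (mem_of_mem_support_decompose hy hj))
    (SetLike.mul_mem_graded (SetLike.coe_mem _) (SetLike.coe_mem _))

variable (𝒜)

/-- The subring `⨁_{i ∈ H} R_i` of a graded ring `R`, for a subgroup `H` of the group of
degrees. -/
def gradedSubalgebra (H : AddSubgroup ι) : Subalgebra K R :=
  (gradedPart 𝒜 (H : Set ι)).toSubalgebra
    (mem_gradedPart_of_mem H.zero_mem SetLike.GradedOne.one_mem)
    (fun _ _ => mul_mem_gradedPart fun _ hi _ hj => H.add_mem hi hj)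

/-- The components of degree outside `H` form a complement stable under `⨁_{i ∈ H} R_i`. -/
instance isNoetherianRing_gradedSubalgebra [IsNoetherianRing R] (H : AddSubgroup ι) :
    IsNoetherianRing (gradedSubalgebra 𝒜 H) := by
  classical
  refine Subalgebra.isNoetherianRing_of_complement _ (gradedPart 𝒜 (H : Set ι)ᶜ) ?_ ?_ ?_
  · intro r
    refine ⟨∑ i ∈ (decompose 𝒜 r).support with i ∈ H, decompose 𝒜 r i, ?_,
      ∑ i ∈ (decompose 𝒜 r).support with i ∉ H, decompose 𝒜 r i, ?_, ?_⟩
    · exact sum_mem fun i hi =>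
        mem_gradedPart_of_mem (Finset.mem_filter.mp hi).2 (SetLike.coe_mem _)
    · exact sum_mem fun i hi =>
        mem_gradedPart_of_mem (Finset.mem_filter.mp hi).2 (SetLike.coe_mem _)
    · rw [Finset.sum_filter_add_sum_filter_not, sum_support_decompose]
  · intro x hx hx'
    refine (decompose 𝒜).injective (by
      ext i
      by_contra h
      simp only [decompose_zero, DirectSum.zero_apply, ZeroMemClass.coe_zero] at h
      exact hx' i h (hx i h))
  · exact fun s hs c hc => mul_mem_gradedPart (s := (H : Set ι)) (t := (H : Set ι)ᶜ)
      (u := (H : Set ι)ᶜ)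
      (fun i hi j hj hij => hj ((H.add_mem_cancel_left hi).mp hij)) hs hc

variable {G : Type*} [AddCommGroup G] (φ : G →+ ι)

/-- The grading of `⨁_{i ∈ φ(G)} R_i` by `G` for which `R_{φ(g)}` has degree `g`. -/
def comapGrading (g : G) : Submodule K (gradedSubalgebra 𝒜 φ.range) :=
  (𝒜 (φ g)).comap (gradedSubalgebra 𝒜 φ.range).val.toLinearMap

lemma mem_comapGrading {g : G} {x : gradedSubalgebra 𝒜 φ.range} :
    x ∈ comapGrading 𝒜 φ g ↔ (x : R) ∈ 𝒜 (φ g) := Iff.rfl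

variable {φ}

lemma isInternal_comapGrading [DecidableEq G] (hφ : Function.Injective φ) :
    DirectSum.IsInternal (comapGrading 𝒜 φ) := by
  classical
  let v := (gradedSubalgebra 𝒜 φ.range).val.toLinearMap
  have hv : Function.Injective v := Subtype.val_injective
  have hind : iSupIndep (𝒜 ∘ φ) :=
    (Decomposition.isInternal 𝒜).submodule_iSupIndep.comp hφ
  rw [isInternal_submodule_iff_iSupIndep_and_iSup_eq_top]
  constructor
  · refine fun g => Submodule.disjoint_def.mpr fun x hx hx' => hv ?_
    refine (Submodule.disjoint_def.mp (hind g) (v x) hx ?_).trans (map_zero v).symm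
    have := Submodule.mem_map_of_mem (f := v) hx'
    simp only [Submodule.map_iSup] at this
    exact iSup₂_mono (fun _ _ => Submodule.map_comap_le _ _) this
  · refine Submodule.eq_top_iff'.mpr fun x => ?_
    suffices v x ∈ (⨆ g, comapGrading 𝒜 φ g).map v by
      obtain ⟨y, hy, hyx⟩ := this
      exact hv hyx ▸ hy
    rw [show v x = _ from (sum_support_decompose 𝒜 (x : R)).symm]
    refine sum_mem fun i hi => ?_
    obtain ⟨g, rfl⟩ := mem_of_mem_support_decompose x.2 hi
    exact ⟨⟨_, mem_gradedPart_of_mem (s := (φ.range : Set ι)) ⟨g, rfl⟩ (SetLike.coe_mem _)⟩,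
      Submodule.mem_iSup_of_mem g (SetLike.coe_mem (decompose 𝒜 (x : R) (φ g))), rfl⟩

/-- The grading `comapGrading` is an algebra grading when `φ` is injective. -/
@[reducible] noncomputable def gradedAlgebraComap [DecidableEq G] (hφ : Function.Injective φ) :
    GradedAlgebra (comapGrading 𝒜 φ) where
  one_mem := by
    rw [mem_comapGrading, map_zero]; exact SetLike.GradedOne.one_mem
  mul_mem g h x y hx hy := by
    rw [mem_comapGrading, map_add]; exact SetLike.mul_mem_graded hx hy
  toDecomposition := (isInternal_comapGrading 𝒜 hφ).chooseDecomposition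

end Restrict

/-! ### Graded fields over a subgroup of the degree group -/

section Restrict

variable {K R ι : Type*} [Field K] [CommRing R] [Algebra K R] [AddCommGroup ι] [DecidableEq ι]
  (𝒜 : ι → Submodule K R) [GradedAlgebra 𝒜] {G : Type*} [AddCommGroup G] {φ : G →+ ι}

/-- The inverse is taken inside the subring: a nonzero `y` of the opposite degree has product with
`x` in `K`. -/
lemma isUnit_of_mem_comapGrading (hunit : ∀ i, ∀ x ∈ 𝒜 i, x ≠ 0 → IsUnit x)
    (hsupp : gradedSupport 𝒜 = Set.univ) (h0 : (𝒜 0 : Set R) = Set.range (algebraMap K R))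
    {g : G} {x : gradedSubalgebra 𝒜 φ.range} (hx : x ∈ comapGrading 𝒜 φ g) (hx0 : x ≠ 0) :
    IsUnit x := by
  obtain ⟨y, hy, hy0⟩ : φ (-g) ∈ gradedSupport 𝒜 := hsupp ▸ Set.mem_univ _
  have hyS : y ∈ gradedSubalgebra 𝒜 φ.range :=
    mem_gradedPart_of_mem (s := (φ.range : Set ι)) ⟨-g, rfl⟩ hy
  have hxR : (x : R) ≠ 0 := fun h => hx0 (Subtype.ext h)
  have hxy : (x : R) * y ∈ (𝒜 0 : Set R) := by
    have := SetLike.mul_mem_graded ((mem_comapGrading 𝒜 φ).mp hx) hy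
    rwa [← map_add, add_neg_cancel, map_zero] at this
  rw [h0] at hxy
  obtain ⟨c, hc⟩ := hxy
  have hc0 : c ≠ 0 := by
    rintro rfl
    rw [map_zero] at hc
    exact hxR ((hunit _ _ hy hy0).mul_left_eq_zero.mp hc.symm)
  refine .of_mul_eq_one (⟨y, hyS⟩ * algebraMap K _ c⁻¹) (Subtype.ext ?_)
  change (x : R) * (y * algebraMap K R c⁻¹) = 1
  rw [← mul_assoc, ← hc, ← map_mul, mul_inv_cancel₀ hc0, map_one]

lemma gradedSupport_comapGrading (hsupp : gradedSupport 𝒜 = Set.univ) :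
    gradedSupport (comapGrading 𝒜 φ) = Set.univ := by
  refine Set.eq_univ_of_forall fun g => ?_
  obtain ⟨y, hy, hy0⟩ : φ g ∈ gradedSupport 𝒜 := hsupp ▸ Set.mem_univ _
  exact ⟨⟨y, mem_gradedPart_of_mem (s := (φ.range : Set ι)) ⟨g, rfl⟩ hy⟩, hy,
    fun h => hy0 (congrArg Subtype.val h)⟩

lemma comapGrading_zero (h0 : (𝒜 0 : Set R) = Set.range (algebraMap K R)) :
    (comapGrading 𝒜 φ 0 : Set (gradedSubalgebra 𝒜 φ.range)) =
      Set.range (algebraMap K (gradedSubalgebra 𝒜 φ.range)) := by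
  ext x
  rw [SetLike.mem_coe, mem_comapGrading, map_zero, ← SetLike.mem_coe, h0]
  exact exists_congr fun c =>
    (Subtype.ext_iff (a1 := algebraMap K (gradedSubalgebra 𝒜 φ.range) c)).symm

/-- A grading by `K`-submodules as a grading by submodules over a smaller ring of scalars. -/
@[reducible] def gradedAlgebraRestrictScalars {K' K R ι : Type*} [CommRing K'] [CommRing K]
    [CommRing R] [Algebra K' K] [Algebra K R] [Algebra K' R] [IsScalarTower K' K R] [AddCommGroup ι]
    [DecidableEq ι] (𝒜 : ι → Submodule K R) (h : GradedAlgebra 𝒜) :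
    GradedAlgebra fun i => (𝒜 i).restrictScalars K' where
  one_mem := h.one_mem
  mul_mem := h.mul_mem
  decompose' := h.decompose'
  left_inv := h.left_inv
  right_inv := h.right_inv

end Restrict

theorem exists_ratFunField_ringEquiv (k : Type u) [Field k] (d : ℕ) :
    Nonempty (RatFunField ℕ k ≃+* LaurentTower.Coeff k (d + 1)) := by
  let e : ℕ ≃ Fin (d + 1) × ℕ :=
    (nonempty_equiv_of_countable (α := ℕ) (β := Fin (d + 1) × ℕ)).some
  exact ⟨IsFractionRing.ringEquivOfRingEquiv (MvPolynomial.renameEquiv k e).toRingEquiv⟩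

/-- A Noetherian graded field `R` with full support and degree-zero part `K` restricts along an
injection `φ : G → ι` to a Noetherian `G`-graded field of the same kind; its scalars are renamed
along an isomorphism `ε`. -/
theorem exists_gradedField_of_injective {K K' R : Type u} [Field K] [Field K'] (ε : K' ≃+* K)
    [CommRing R] [IsNoetherianRing R] [Nontrivial R] [Algebra K R] {ι : Type*} [AddCommGroup ι]
    [DecidableEq ι] (𝒜 : ι → Submodule K R) [GradedAlgebra 𝒜]
    (hunit : ∀ i, ∀ x ∈ 𝒜 i, x ≠ 0 → IsUnit x)
    (hsupp : gradedSupport 𝒜 = Set.univ) (h0 : (𝒜 0 : Set R) = Set.range (algebraMap K R))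
    {G : Type v} [AddCommGroup G] [DecidableEq G] {φ : G →+ ι} (hφ : Function.Injective φ) :
    ∃ (S : Type u) (_ : CommRing S) (_ : Algebra K' S)
        (ℬ : G → Submodule K' S) (_ : GradedAlgebra ℬ),
        IsNoetherianRing S ∧ IsGradedField ℬ ∧ gradedSupport ℬ = Set.univ ∧
        (ℬ 0 : Set S) = Set.range (algebraMap K' S) := by
  let S := gradedSubalgebra 𝒜 φ.range
  let : Algebra K' K := (ε : K' →+* K).toAlgebra
  let : Algebra K' S := ((algebraMap K S).comp (ε : K' →+* K)).toAlgebra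
  have : IsScalarTower K' K S := .of_algebraMap_eq' rfl
  let ℬ (g : G) : Submodule K' S := (comapGrading 𝒜 φ g).restrictScalars K'
  let hℬ : GradedAlgebra ℬ := gradedAlgebraRestrictScalars (comapGrading 𝒜 φ)
    (gradedAlgebraComap 𝒜 hφ)
  refine ⟨S, inferInstance, inferInstance, ℬ, hℬ, inferInstance, ?_, ?_, ?_⟩
  · exact isGradedField_of_isUnit ℬ fun g x hx hx0 =>
      isUnit_of_mem_comapGrading 𝒜 hunit hsupp h0 hx hx0
  · exact gradedSupport_comapGrading 𝒜 hsupp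
  · refine (comapGrading_zero 𝒜 h0).trans ?_
    rw [IsScalarTower.algebraMap_eq K' K S, RingHom.coe_comp]
    exact (ε.surjective.range_comp _).symm

theorem theorem4p1 (k : Type u) [Field k] [CharZero k] :
    (∀ (d : ℕ) (p : ℕ → ℕ), (∀ i, (p i).Prime) →
      (∀ q : ℚ, ∃ (n : ℕ) (m : ℤ), q = (m : ℚ) / ∏ i ∈ Finset.range n, (p i : ℚ)) →
      IsNoetherianRing (LaurentTower.Limit k d p) ∧
      ∃ _ : GradedAlgebra (LaurentTower.component k d p),
        IsGradedField (LaurentTower.component k d p) ∧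
        gradedSupport (LaurentTower.component k d p) = Set.univ) ∧
    (∀ (G : Type v) [AddCommGroup G] [DecidableEq G] [IsAddTorsionFree G],
      Module.rank ℤ G < Cardinal.aleph0 →
      ∃ (R : Type u) (_ : CommRing R) (_ : Algebra (RatFunField ℕ k) R)
        (𝒜 : G → Submodule (RatFunField ℕ k) R) (_ : GradedAlgebra 𝒜),
        IsNoetherianRing R ∧ IsGradedField 𝒜 ∧ gradedSupport 𝒜 = Set.univ ∧
        (𝒜 0 : Set R) = Set.range (algebraMap (RatFunField ℕ k) R)) := by
  refine ⟨fun d p hp hq => ?_, fun G _ _ _ hG => ?_⟩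
  · have hp0 (i) : p i ≠ 0 := (hp i).ne_zero
    let := LaurentTower.gradedAlgebra k d hp0
    exact ⟨LaurentTower.isNoetherianRing_limit k d p hp0, this,
      isGradedField_of_isUnit _ fun g x => LaurentTower.isUnit_of_mem_component k d hp0,
      LaurentTower.gradedSupport_component k d hp0 hq⟩
  · obtain ⟨d, φ, hφ⟩ := exists_injective_of_rank_lt_aleph0 G hG
    obtain ⟨p, hp, hq⟩ := exists_prime_seq
    have hp0 (i) : p i ≠ 0 := (hp i).ne_zero
    obtain ⟨ε⟩ := exists_ratFunField_ringEquiv k d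
    let := LaurentTower.gradedAlgebra k (d + 1) hp0
    have := LaurentTower.isNoetherianRing_limit k (d + 1) p hp0
    exact exists_gradedField_of_injective ε (LaurentTower.component k (d + 1) p)
      (fun _ _ => LaurentTower.isUnit_of_mem_component k (d + 1) hp0)
      (LaurentTower.gradedSupport_component k (d + 1) hp0 hq)
      (LaurentTower.component_zero k (d + 1) hp0) hφ
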